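/- Let $E$ be a real Banach space with dual space $E'$, and let $B_{E'}=\{f\in E' : \|f\|_{E'}\le 1\}$ be the closed unit ball of the dual. Let $(\Omega,\mathcal A,\mathbb P)$ be a complete probability space with expectation $\mathbb E$, let $M\in\mathbb N$, and let $g_1,\dots,g_M$ be independent standard normal random variables on $\Omega$. Let $\Psi\colon\mathbb R^2\to\mathbb R$ be continuous with $\Psi(0,0)=0$, let $x_1,\dots,x_M,y_1,\dots,y_M\in E$, and define $$\mathcal G_1(f):=\sum_{j=1}^M g_j\,\Psi\bigl(f(x_j),f(y_j)\bigr),\qquad f\in B_{E'}.$$ Let $\mathcal G_2\colon B_{E'}\times\Omega\to\mathbb R$ be a centered Gaussian process on $(\Omega,\mathcal A,\mathbb P)$ such that $$\mathbb E\bigl[|\mathcal G_1(f)-\mathcal G_1(h)|^2\bigr]\le \mathbb E\bigl[|\mathcal G_2(f)-\mathcal G_2(h)|^2\bigr]\qquad\text{for all } f,h\in B_{E'}.$$ Then $\mathcal G_1$ is a centered Gaussian process, $\sup_{f\in B_{E'}}|\mathcal G_1(f)|$ is measurable, and for every $q\in[1,\infty)$ $$\mathbb E\Bigl[\bigl(\sup_{f\in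 B_{E'}}|\mathcal G_1(f)|\bigr)^q\Bigr]\le 2^q\,\mathbb E\Bigl[\bigl(\sup_{f\in B_{E'}}|\mathcal G_2(f)|\bigr)^q\Bigr],$$ where the suprema are taken pointwise on $\Omega$ with values in $[0,\infty]$, and both sides take values in $[0,\infty]$. If $\sup_{f\in B_{E'}}|\mathcal G_2(f)|$ is not measurable, the expectation on the right is understood as the lower integral, that is, the supremum of the integrals of the measurable functions below the integrand. -/

import Mathlib

/-!
For centered Gaussian vectors `X` and `Y`, taken independent, Gaussian integration by parts gives
the derivative of `θ ↦ 𝔼 f (cos θ • X + sin θ • Y)` as `sin θ * cos θ` times the expectation of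
`tr (f'' (cov Y - cov X))`. If `f` is a smoothed hinge of the range `max z - min z`, its second
derivative is a combination `∑ w i j * (v i - v j) ^ 2` with `w i j ≥ 0`, so it suffices to compare
the increments of `X` and `Y`. Rescaling removes the smoothing and leaves
`𝔼 (range X - a)₊ ≤ 𝔼 (range Y - a)₊` for every `a`, and integrating against `a ^ (q - 2)` turns
this into an inequality of `q`-th moments. As `𝒢₁` vanishes at `f = 0`, its absolute supremum is at
most its range, while the range of `𝒢₂` is at most twice its absolute supremum: this is the factor
`2 ^ q`. Countably many `f` suffice for `𝒢₁` because `𝒢₁(f)` depends continuously on the finitely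
many numbers `f (x j)`, `f (y j)`.
-/

open MeasureTheory ProbabilityTheory
open scoped ENNReal

/-- An orthogaussian family: independent real random variables, each with the standard normal
law `N(0,1)`. -/
structure IsOrthogaussian {ι Ω : Type*} [MeasurableSpace Ω] (g : ι → Ω → ℝ) (P : Measure Ω) :
    Prop where
  hasLaw : ∀ j, HasLaw (g j) (gaussianReal 0 1) P
  iIndepFun : iIndepFun g P

/-- A centered real Gaussian process: all finite-dimensional marginals are (possibly degenerate)
Gaussian, and each coordinate has expectation zero. -/
structure IsCenteredGaussianFamily {T Ω : Type*} [MeasurableSpace Ω] (G : T → Ω → ℝ)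
    (P : Measure Ω) : Prop where
  isGaussianProcess : IsGaussianProcess G P
  integral_eq_zero : ∀ t, ∫ ω, G t ω ∂P = 0

/-- The closed unit ball of the (normed) dual space of `E`. -/
abbrev DualUnitBall (E : Type*) [NormedAddCommGroup E] [NormedSpace ℝ E] : Type _ :=
  Metric.closedBall (0 : StrongDual ℝ E) 1

/-- The process `f ↦ ∑ j, g j * Ψ (f (x j), f (y j))` indexed by the dual unit ball. -/
def gaussianSum {E Ω : Type*} [NormedAddCommGroup E] [NormedSpace ℝ E] {M : ℕ}
    (g : Fin M → Ω → ℝ) (Ψ : ℝ × ℝ → ℝ) (x y : Fin M → E) (f : DualUnitBall E) (ω : Ω) : ℝ :=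
  ∑ j, g j ω * Ψ (f.1 (x j), f.1 (y j))

/-- The pointwise supremum `sup_t |G t ω|`, as an element of `[0, ∞]`. -/
noncomputable def supAbs {T Ω : Type*} (G : T → Ω → ℝ) (ω : Ω) : ℝ≥0∞ :=
  ⨆ t, ENNReal.ofReal |G t ω|

section Stein

variable {m : ℝ} {v : NNReal}

theorem hasDerivAt_gaussianPDFReal (m : ℝ) (v : NNReal) (x : ℝ) :
    HasDerivAt (gaussianPDFReal m v) (-((x - m) / v) * gaussianPDFReal m v x) x := by
  have hexponent : HasDerivAt (fun y : ℝ ↦ -(y - m) ^ 2 / (2 * v)) (-((x - m) / v)) x := by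
    refine ((((hasDerivAt_id x).sub_const m).pow 2).neg.div_const (2 * (v : ℝ))).congr_deriv ?_
    simp only [id, Nat.cast_ofNat, Nat.add_one_sub_one, pow_one, mul_one, ← neg_div]
    rw [← mul_neg, mul_div_mul_left _ _ two_ne_zero]
  rw [gaussianPDFReal_def]
  exact (hexponent.exp.const_mul _).congr_deriv (by ring)

theorem integrable_gaussianReal_iff {F : Type*} [NormedAddCommGroup F] [NormedSpace ℝ F]
    (hv : v ≠ 0) {f : ℝ → F} :
    Integrable f (gaussianReal m v) ↔ Integrable (fun x ↦ gaussianPDFReal m v x • f x) := by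
  rw [gaussianReal_of_var_ne_zero m hv,
    integrable_withDensity_iff_integrable_smul' (measurable_gaussianPDF m v)
      (ae_of_all _ fun _ ↦ gaussianPDF_lt_top)]
  simp only [toReal_gaussianPDF]

theorem integral_sub_mul_gaussianReal {h h' : ℝ → ℝ} (hderiv : ∀ x, HasDerivAt h (h' x) x)
    (hh : Integrable h (gaussianReal m v)) (hh' : Integrable h' (gaussianReal m v))
    (hxh : Integrable (fun x ↦ (x - m) * h x) (gaussianReal m v)) :
    ∫ x, (x - m) * h x ∂gaussianReal m v = v * ∫ x, h' x ∂gaussianReal m v := by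
  rcases eq_or_ne v 0 with rfl | hv
  · simp
  have hv' : (v : ℝ) ≠ 0 := by exact_mod_cast hv
  rw [integrable_gaussianReal_iff hv] at hh hh' hxh
  simp only [integral_gaussianReal_eq_integral_smul hv, smul_eq_mul] at *
  have hzero := integral_eq_zero_of_hasDerivAt_of_integrable
    (f := fun x ↦ gaussianPDFReal m v x * h x)
    (f' := fun x ↦ gaussianPDFReal m v x * h' x
      - (v : ℝ)⁻¹ * (gaussianPDFReal m v x * ((x - m) * h x)))
    (fun x ↦ ((hasDerivAt_gaussianPDFReal m v x).mul (hderiv x)).congr_deriv (by ring))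
    (hh'.sub (hxh.const_mul _)) hh
  rw [integral_sub hh' (hxh.const_mul _), integral_const_mul, sub_eq_zero] at hzero
  rw [hzero, mul_inv_cancel_left₀ hv']

end Stein

section IntegrationByParts

variable {Ω F : Type*} [MeasurableSpace Ω] {P : Measure Ω} {ξ : Ω → ℝ}
  [NormedAddCommGroup F] [NormedSpace ℝ F]

theorem exists_integral_smul_eq_variance_smul {Z : Ω → F}
    [IsProbabilityMeasure P] (hξ2 : MemLp ξ 2 P) (hξ : ∫ ω, ξ ω ∂P = 0) :
    ∃ c : F, ∫ ω, ξ ω • Z ω ∂P = Var[ξ; P] • c := by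
  rcases eq_or_ne Var[ξ; P] 0 with hvar | hvar
  · refine ⟨0, ?_⟩
    rw [smul_zero]
    refine integral_eq_zero_of_ae ?_
    filter_upwards [ae_eq_integral_of_variance_eq_zero hξ2 hvar] with ω hω
    rw [hω, hξ, zero_smul, Pi.zero_apply]
  · exact ⟨Var[ξ; P]⁻¹ • ∫ ω, ξ ω • Z ω ∂P, (smul_inv_smul₀ hvar _).symm⟩

variable [MeasurableSpace F] [BorelSpace F] [SecondCountableTopology F]

theorem integral_mul_comp_add_smul_of_indepFun {W : Ω → F} {h : F → ℝ} {h' : F → F →L[ℝ] ℝ}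
    {C C' : ℝ} (hξg : HasGaussianLaw ξ P) (hξ : ∫ ω, ξ ω ∂P = 0) (hW : AEMeasurable W P)
    (hind : IndepFun ξ W P) (hd : ∀ z, HasFDerivAt h (h' z) z)
    (hC : ∀ z, |h z| ≤ C) (hC' : ∀ z, ‖h' z‖ ≤ C') (c : F) :
    ∫ ω, ξ ω * h (W ω + ξ ω • c) ∂P = Var[ξ; P] * ∫ ω, h' (W ω + ξ ω • c) c ∂P := by
  have := hξg.isProbabilityMeasure
  have : IsProbabilityMeasure (P.map W) := Measure.isProbabilityMeasure_map hW
  set γ : Measure ℝ := gaussianReal 0 Var[ξ; P].toNNReal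
  have hlaw : P.map (fun ω ↦ (ξ ω, W ω)) = γ.prod (P.map W) := by
    rw [(indepFun_iff_map_prod_eq_prod_map_map hξg.aemeasurable hW).1 hind,
      hξg.map_eq_gaussianReal, hξ]
  have hpair : AEMeasurable (fun ω ↦ (ξ ω, W ω)) P := hξg.aemeasurable.prodMk hW
  have hcont : Continuous h := continuous_iff_continuousAt.2 fun z ↦ (hd z).continuousAt
  have hmeas : Measurable fun z ↦ h' z c := by
    simpa only [(hd _).fderiv] using measurable_fderiv_apply_const ℝ h c
  have hbound (z : F) : ‖h' z c‖ ≤ C' * ‖c‖ := (h' z).le_of_opNorm_le (hC' z) c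
  have hid : Integrable id γ := IsGaussian.integrable_id
  have hleft : ∫ ω, ξ ω * h (W ω + ξ ω • c) ∂P
      = ∫ w, ∫ x, x * h (w + x • c) ∂γ ∂(P.map W) := by
    rw [← integral_prod_symm (fun z : ℝ × F ↦ z.1 * h (z.2 + z.1 • c)), ← hlaw,
      integral_map hpair (by fun_prop)]
    exact (hid.comp_fst _).mul_bdd (c := C) (by fun_prop) (ae_of_all _ fun z ↦ hC _)
  have hright : ∫ ω, h' (W ω + ξ ω • c) c ∂P
      = ∫ w, ∫ x, h' (w + x • c) c ∂γ ∂(P.map W) := by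
    have hmeas' : Measurable fun z : ℝ × F ↦ h' (z.2 + z.1 • c) c :=
      hmeas.comp (by fun_prop)
    rw [← integral_prod_symm (fun z : ℝ × F ↦ h' (z.2 + z.1 • c) c), ← hlaw,
      integral_map hpair hmeas'.aestronglyMeasurable]
    exact .of_bound hmeas'.aestronglyMeasurable _ (ae_of_all _ fun z ↦ hbound _)
  rw [hleft, hright, ← integral_const_mul]
  congr with w
  have hline (x : ℝ) : HasDerivAt (fun x : ℝ ↦ h (w + x • c)) (h' (w + x • c) c) x :=
    (hd _).comp_hasDerivAt x (by simpa using ((hasDerivAt_id x).smul_const c).const_add w)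
  have hstein := integral_sub_mul_gaussianReal (m := 0) (v := Var[ξ; P].toNNReal) hline
    (.of_bound (by fun_prop) C (ae_of_all _ fun x ↦ hC _))
    (.of_bound (hmeas.comp (by fun_prop)).aestronglyMeasurable _ (ae_of_all _ fun x ↦ hbound _))
    (by simpa using hid.mul_bdd (by fun_prop) (ae_of_all _ fun x ↦ hC _))
  simpa only [sub_zero, Real.coe_toNNReal _ (variance_nonneg ξ P)] using hstein

variable [CompleteSpace F]

theorem indepFun_of_integral_smul_eq_zero {W : Ω → F}
    (hξW : HasGaussianLaw (fun ω ↦ (ξ ω, W ω)) P) (hξ : ∫ ω, ξ ω ∂P = 0)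
    (hcross : ∫ ω, ξ ω • W ω ∂P = 0) : IndepFun ξ W P := by
  have := hξW.isProbabilityMeasure
  have hξ2 : MemLp ξ 2 P := hξW.fst.memLp_two
  have hW2 : MemLp W 2 P := hξW.snd.memLp_two
  refine hξW.indepFun_of_covariance_strongDual fun L₁ L₂ ↦ ?_
  have hL₁ : L₁ ∘ ξ = fun ω ↦ ξ ω * L₁ 1 := by
    ext ω
    simpa using L₁.map_smul (ξ ω) 1
  have hL₂ : ∫ ω, ξ ω * L₂ (W ω) ∂P = 0 := by
    have hξW1 : Integrable (fun ω ↦ ξ ω • W ω) P := memLp_one_iff_integrable.1 (hW2.smul hξ2)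
    simpa only [hcross, map_zero, map_smul, smul_eq_mul] using L₂.integral_comp_comm hξW1
  rw [hL₁, covariance_mul_const_left, covariance_eq_sub hξ2 (L₂.comp_memLp' hW2), hξ]
  simp only [Pi.mul_apply, Function.comp_apply, hL₂, zero_mul, sub_zero]

theorem integral_mul_comp_of_hasGaussianLaw {Z : Ω → F} {h : F → ℝ} {h' : F → F →L[ℝ] ℝ}
    {C C' : ℝ} (hξZ : HasGaussianLaw (fun ω ↦ (ξ ω, Z ω)) P) (hξ : ∫ ω, ξ ω ∂P = 0)
    (hd : ∀ z, HasFDerivAt h (h' z) z) (hC : ∀ z, |h z| ≤ C) (hC' : ∀ z, ‖h' z‖ ≤ C') :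
    ∫ ω, ξ ω * h (Z ω) ∂P = ∫ ω, h' (Z ω) (∫ ω', ξ ω' • Z ω' ∂P) ∂P := by
  have := hξZ.isProbabilityMeasure
  have hξ2 : MemLp ξ 2 P := hξZ.fst.memLp_two
  have hξZ1 : Integrable (fun ω ↦ ξ ω • Z ω) P :=
    memLp_one_iff_integrable.1 (hξZ.snd.memLp_two.smul hξ2)
  obtain ⟨c, hc⟩ := exists_integral_smul_eq_variance_smul (Z := Z) hξ2 hξ
  -- `Z` splits into a multiple of `ξ` and a residual `W` that is independent of `ξ`.
  set W : Ω → F := fun ω ↦ Z ω - ξ ω • c with hW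
  have hξW : HasGaussianLaw (fun ω ↦ (ξ ω, W ω)) P :=
    hξZ.map_fun ((ContinuousLinearMap.fst ℝ ℝ F).prod (ContinuousLinearMap.snd ℝ ℝ F -
      (ContinuousLinearMap.fst ℝ ℝ F).smulRight c))
  have hcross : ∫ ω, ξ ω • W ω ∂P = 0 := by
    simp only [hW, smul_sub, smul_smul, ← sq]
    rw [integral_sub hξZ1 (hξ2.integrable_sq.smul_const c), integral_smul_const, hc,
      variance_of_integral_eq_zero hξ2.aemeasurable hξ, sub_self]
  have hind : IndepFun ξ W P := indepFun_of_integral_smul_eq_zero hξW hξ hcross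
  have hibp := integral_mul_comp_add_smul_of_indepFun hξZ.fst hξ hξW.snd.aemeasurable hind
    hd hC hC' c
  simp only [hW, sub_add_cancel] at hibp
  simp only [hibp, hc, ← integral_const_mul, map_smul, smul_eq_mul]

end IntegrationByParts

section VectorIntegrationByParts

variable {Ω E F : Type*} [MeasurableSpace Ω] {P : Measure Ω}
  [NormedAddCommGroup E] [NormedSpace ℝ E] [NormedAddCommGroup F] [NormedSpace ℝ F]
  {G : F → E →L[ℝ] ℝ} {G' : F → F →L[ℝ] E →L[ℝ] ℝ} {C C' : ℝ} {Z : Ω → F}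

theorem hasFDerivAt_apply_const {z : F} (hd : HasFDerivAt G (G' z) z) (e : E) :
    HasFDerivAt (fun z ↦ G z e) ((G' z).flip e) z := by
  simpa using hd.clm_apply (hasFDerivAt_const e z)

theorem integral_apply_smul {ℓ : Ω → ℝ} [CompleteSpace F]
    (hℓZ : Integrable (fun ω ↦ ℓ ω • Z ω) P) (B : F →L[ℝ] E →L[ℝ] ℝ) (e : E) :
    ∫ ω, B (Z ω) (ℓ ω • e) ∂P = B (∫ ω, ℓ ω • Z ω ∂P) e := by
  simpa using (B.flip e).integral_comp_comm hℓZ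

variable [MeasurableSpace F] [BorelSpace F]

theorem integrable_apply_flip [IsFiniteMeasure P] (hZ : AEMeasurable Z P)
    (hd : ∀ z, HasFDerivAt G (G' z) z) (hC' : ∀ z, ‖G' z‖ ≤ C') (v : F) (e : E) :
    Integrable (fun ω ↦ G' (Z ω) v e) P := by
  have hde (z : F) : HasFDerivAt (fun z ↦ G z e) ((G' z).flip e) z :=
    hasFDerivAt_apply_const (hd z) e
  have hmeas : Measurable fun z ↦ G' z v e := by
    simpa only [(hde _).fderiv, ContinuousLinearMap.flip_apply] using
      measurable_fderiv_apply_const ℝ (fun z ↦ G z e) v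
  exact .of_bound (hmeas.comp_aemeasurable hZ).aestronglyMeasurable _
    (ae_of_all _ fun ω ↦ (G' (Z ω)).le_of_opNorm₂_le_of_le (hC' _) le_rfl le_rfl)

variable [SecondCountableTopology F] [CompleteSpace F]

theorem integral_apply_smul_of_hasGaussianLaw {ℓ : Ω → ℝ}
    (hℓZ : HasGaussianLaw (fun ω ↦ (ℓ ω, Z ω)) P) (hℓ : ∫ ω, ℓ ω ∂P = 0)
    (hd : ∀ z, HasFDerivAt G (G' z) z) (hC : ∀ z, ‖G z‖ ≤ C) (hC' : ∀ z, ‖G' z‖ ≤ C') (e : E) :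
    ∫ ω, G (Z ω) (ℓ ω • e) ∂P = ∫ ω, G' (Z ω) (∫ ω', ℓ ω' • Z ω' ∂P) e ∂P := by
  simpa using integral_mul_comp_of_hasGaussianLaw hℓZ hℓ (C := C * ‖e‖) (C' := C' * ‖e‖)
    (fun z ↦ hasFDerivAt_apply_const (hd z) e) (fun z ↦ (G z).le_of_opNorm_le (hC z) e)
    (fun z ↦ (G' z).flip.le_of_opNorm_le ((G' z).opNorm_flip.trans_le (hC' z)) e)

theorem integral_apply_of_hasGaussianLaw [FiniteDimensional ℝ E]
    [MeasurableSpace E] [BorelSpace E] {ξ : Ω → E}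
    (hξZ : HasGaussianLaw (fun ω ↦ (ξ ω, Z ω)) P) (hξ : ∫ ω, ξ ω ∂P = 0)
    (hd : ∀ z, HasFDerivAt G (G' z) z) (hC : ∀ z, ‖G z‖ ≤ C) (hC' : ∀ z, ‖G' z‖ ≤ C') :
    ∫ ω, G (Z ω) (ξ ω) ∂P = ∫ ω, ∫ ω', G' (Z ω) (Z ω') (ξ ω') ∂P ∂P := by
  have := hξZ.isProbabilityMeasure
  have : CompleteSpace E := FiniteDimensional.complete ℝ E
  let b := Module.finBasis ℝ E
  let coord (i) : E →L[ℝ] ℝ := (b.coord i).toContinuousLinearMap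
  have hξb (ω) : ξ ω = ∑ i, coord i (ξ ω) • b i := (b.sum_repr (ξ ω)).symm
  have hcoord (i) : HasGaussianLaw (fun ω ↦ (coord i (ξ ω), Z ω)) P :=
    hξZ.map_fun ((coord i).prodMap (.id ℝ F))
  have hcoord0 (i) : ∫ ω, coord i (ξ ω) ∂P = 0 := by
    rw [(coord i).integral_comp_comm hξZ.fst.integrable, hξ, map_zero]
  have hcoordZ (i) : Integrable (fun ω ↦ coord i (ξ ω) • Z ω) P :=
    memLp_one_iff_integrable.1 (hξZ.snd.memLp_two.smul (hcoord i).fst.memLp_two)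
  have hG : Continuous G := continuous_iff_continuousAt.2 fun z ↦ (hd z).continuousAt
  have hGZ (e) : AEStronglyMeasurable (fun ω ↦ G (Z ω) e) P :=
    ((by fun_prop : Measurable fun z ↦ G z e).comp_aemeasurable
      hξZ.snd.aemeasurable).aestronglyMeasurable
  have hGint (i) : Integrable (fun ω ↦ G (Z ω) (coord i (ξ ω) • b i)) P := by
    simpa using (hcoord i).fst.integrable.mul_bdd (hGZ (b i))
      (ae_of_all _ fun ω ↦ (G (Z ω)).le_of_opNorm_le (hC _) (b i))
  have hGint' (z) (i) : Integrable (fun ω' ↦ G' z (Z ω') (coord i (ξ ω') • b i)) P := by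
    simpa using ((G' z).flip (b i)).integrable_comp (hcoordZ i)
  calc ∫ ω, G (Z ω) (ξ ω) ∂P
      = ∑ i, ∫ ω, G (Z ω) (coord i (ξ ω) • b i) ∂P := by
        rw [← integral_finsetSum _ fun i _ ↦ hGint i]
        simp_rw [← map_sum, ← hξb]
    _ = ∫ ω, ∑ i, G' (Z ω) (∫ ω', coord i (ξ ω') • Z ω' ∂P) (b i) ∂P := by
        rw [integral_finsetSum _ fun i _ ↦
          integrable_apply_flip hξZ.snd.aemeasurable hd hC' _ (b i)]
        exact Finset.sum_congr rfl fun i _ ↦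
          integral_apply_smul_of_hasGaussianLaw (hcoord i) (hcoord0 i) hd hC hC' (b i)
    _ = ∫ ω, ∫ ω', G' (Z ω) (Z ω') (ξ ω') ∂P ∂P := by
        simp_rw [← integral_apply_smul (hcoordZ _),
          ← integral_finsetSum _ fun i _ ↦ hGint' _ i, ← map_sum, ← hξb]

end VectorIntegrationByParts

section Interpolation

variable {Ω Ω' E : Type*} [NormedAddCommGroup E] [NormedSpace ℝ E]

/-- The rotation `cos θ • X + sin θ • Y` of two random vectors, realised on the product of their
probability spaces so that `X` and `Y` become independent. Its derivative in `θ` is the rotation by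
the angle `θ + π / 2`. -/
noncomputable def rotationPath (X : Ω → E) (Y : Ω' → E) (θ : ℝ) (ω : Ω × Ω') : E :=
  Real.cos θ • X ω.1 + Real.sin θ • Y ω.2

theorem hasDerivAt_rotationPath (X : Ω → E) (Y : Ω' → E) (θ : ℝ) (ω : Ω × Ω') :
    HasDerivAt (rotationPath X Y · ω) (rotationPath X Y (θ + Real.pi / 2) ω) θ := by
  rw [rotationPath, Real.cos_add_pi_div_two, Real.sin_add_pi_div_two]
  exact ((Real.hasDerivAt_cos θ).smul_const _).add ((Real.hasDerivAt_sin θ).smul_const _)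

theorem norm_rotationPath_le (X : Ω → E) (Y : Ω' → E) (θ : ℝ) (ω : Ω × Ω') :
    ‖rotationPath X Y θ ω‖ ≤ ‖X ω.1‖ + ‖Y ω.2‖ := by
  refine norm_add_le_of_le ?_ ?_ <;> rw [norm_smul]
  · exact mul_le_of_le_one_left (norm_nonneg _) (Real.abs_cos_le_one θ)
  · exact mul_le_of_le_one_left (norm_nonneg _) (Real.abs_sin_le_one θ)

variable [MeasurableSpace Ω] {P : Measure Ω} [MeasurableSpace Ω'] {Q : Measure Ω'}
  {X : Ω → E} {Y : Ω' → E}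

theorem integrable_comp_of_lipschitzWith [IsFiniteMeasure P] {F G : Type*} [NormedAddCommGroup F]
    [NormedAddCommGroup G] {K : NNReal} {h : F → G} {X : Ω → F} (hh : LipschitzWith K h)
    (hX : Integrable X P) : Integrable (fun ω ↦ h (X ω)) P := by
  have hsub : LipschitzWith K fun z ↦ h z - h 0 := fun y z ↦ by
    simpa only [edist_sub_right] using hh y z
  have hcomp : Integrable (fun ω ↦ h (X ω) - h 0) P := memLp_one_iff_integrable.1
    (hsub.comp_memLp (sub_self _) (memLp_one_iff_integrable.2 hX))
  exact (hcomp.add (integrable_const (h 0))).congr (ae_of_all _ fun ω ↦ sub_add_cancel _ _)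

theorem integral_rotationPath_eq_zero [IsProbabilityMeasure P] [IsProbabilityMeasure Q]
    (hX : Integrable X P) (hY : Integrable Y Q)
    (hX0 : ∫ ω, X ω ∂P = 0) (hY0 : ∫ ω, Y ω ∂Q = 0) (θ : ℝ) :
    ∫ ω, rotationPath X Y θ ω ∂P.prod Q = 0 := by
  simp only [rotationPath]
  rw [integral_add (by exact (hX.comp_fst Q).smul _) (by exact (hY.comp_snd P).smul _),
    integral_smul, integral_smul, integral_fun_fst, integral_fun_snd, hX0, hY0]
  simp only [smul_zero, add_zero]

theorem integral_bilin_rotationPath [CompleteSpace E]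
    [IsProbabilityMeasure P] [IsProbabilityMeasure Q] (hX : MemLp X 2 P) (hY : MemLp Y 2 Q)
    (hX0 : ∫ ω, X ω ∂P = 0) (hY0 : ∫ ω, Y ω ∂Q = 0)
    (B : E →L[ℝ] E →L[ℝ] ℝ) (θ : ℝ) :
    ∫ ω, B (rotationPath X Y θ ω) (rotationPath X Y (θ + Real.pi / 2) ω) ∂P.prod Q
      = Real.sin θ * Real.cos θ * (∫ ω, B (Y ω) (Y ω) ∂Q - ∫ ω, B (X ω) (X ω) ∂P) := by
  have hX1 := hX.integrable one_le_two
  have hY1 := hY.integrable one_le_two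
  have hXX := (memLp_one_iff_integrable.1 (B.memLp_of_bilin 1 hX hX)).comp_fst Q
  have hYY := (memLp_one_iff_integrable.1 (B.memLp_of_bilin 1 hY hY)).comp_snd P
  have hXY := hX1.op_fst_snd (op := (B · ·)) (by fun_prop) ⟨‖B‖, B.le_opNorm₂⟩ hY1
  have hYX := hX1.op_fst_snd (op := (B.flip · ·)) (by fun_prop) ⟨‖B.flip‖, B.flip.le_opNorm₂⟩ hY1
  have hXY0 := integral_prod_bilin B hX1 hY1
  have hYX0 := integral_prod_bilin B.flip hX1 hY1
  simp only [ContinuousLinearMap.flip_apply, hX0, hY0, map_zero] at hYX hXY0 hYX0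
  have hexpand (ω : Ω × Ω') : B (rotationPath X Y θ ω) (rotationPath X Y (θ + Real.pi / 2) ω)
      = Real.sin θ * Real.cos θ * (B (Y ω.2) (Y ω.2) - B (X ω.1) (X ω.1))
        + (Real.cos θ ^ 2 * B (X ω.1) (Y ω.2) - Real.sin θ ^ 2 * B (Y ω.2) (X ω.1)) := by
    simp only [rotationPath, Real.cos_add_pi_div_two, Real.sin_add_pi_div_two, map_add, map_smul,
      add_apply, smul_apply, smul_eq_mul]
    ring
  have hdiag : ∫ ω : Ω × Ω', (B (Y ω.2) (Y ω.2) - B (X ω.1) (X ω.1)) ∂P.prod Q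
      = ∫ ω, B (Y ω) (Y ω) ∂Q - ∫ ω, B (X ω) (X ω) ∂P := by
    rw [integral_sub hYY hXX, integral_fun_snd (fun ω ↦ B (Y ω) (Y ω)),
      integral_fun_fst (fun ω ↦ B (X ω) (X ω)), probReal_univ, probReal_univ, one_smul, one_smul]
  have hcross : ∫ ω : Ω × Ω', (Real.cos θ ^ 2 * B (X ω.1) (Y ω.2)
      - Real.sin θ ^ 2 * B (Y ω.2) (X ω.1)) ∂P.prod Q = 0 := by
    rw [integral_sub (hXY.const_mul _) (hYX.const_mul _), integral_const_mul, integral_const_mul,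
      hXY0, hYX0, mul_zero, mul_zero, sub_zero]
  simp only [hexpand]
  rw [integral_add (by exact (hYY.sub hXX).const_mul _)
    (by exact (hXY.const_mul _).sub (hYX.const_mul _)), integral_const_mul, hdiag, hcross, add_zero]

section Gaussian

variable [MeasurableSpace E]

theorem hasGaussianLaw_comp_measurePreserving {φ : Ω' → Ω} (hX : HasGaussianLaw X P)
    (hφ : MeasurePreserving φ Q P) : HasGaussianLaw (fun ω ↦ X (φ ω)) Q where
  isGaussian_map := by
    have := hX.isGaussian_map
    have hXφ : AEMeasurable X (Q.map φ) := hφ.map_eq ▸ hX.aemeasurable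
    rw [← Function.comp_def, ← AEMeasurable.map_map_of_aemeasurable hXφ hφ.aemeasurable, hφ.map_eq]
    infer_instance

variable [BorelSpace E] [SecondCountableTopology E] [CompleteSpace E]

theorem hasGaussianLaw_prodMk_prod (hX : HasGaussianLaw X P) (hY : HasGaussianLaw Y Q) :
    HasGaussianLaw (fun ω : Ω × Ω' ↦ (X ω.1, Y ω.2)) (P.prod Q) := by
  have := hX.isProbabilityMeasure
  have := hY.isProbabilityMeasure
  exact (indepFun_prod₀ hX.aemeasurable hY.aemeasurable).hasGaussianLaw
    (hasGaussianLaw_comp_measurePreserving hX measurePreserving_fst)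
    (hasGaussianLaw_comp_measurePreserving hY measurePreserving_snd)

theorem hasGaussianLaw_rotationPath (hX : HasGaussianLaw X P) (hY : HasGaussianLaw Y Q)
    (θ₁ θ₂ : ℝ) :
    HasGaussianLaw (fun ω ↦ (rotationPath X Y θ₁ ω, rotationPath X Y θ₂ ω)) (P.prod Q) :=
  (hasGaussianLaw_prodMk_prod hX hY).map_fun <|
    (Real.cos θ₁ • ContinuousLinearMap.fst ℝ E E + Real.sin θ₁ • ContinuousLinearMap.snd ℝ E E).prod
    (Real.cos θ₂ • ContinuousLinearMap.fst ℝ E E + Real.sin θ₂ • ContinuousLinearMap.snd ℝ E E)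

theorem hasDerivAt_integral_comp_rotationPath {f : E → ℝ} {f' : E → E →L[ℝ] ℝ} {C : ℝ}
    (hX : HasGaussianLaw X P) (hY : HasGaussianLaw Y Q)
    (hf : ∀ z, HasFDerivAt f (f' z) z) (hf' : Continuous f')
    (hC : ∀ z, ‖f' z‖ ≤ C) (θ : ℝ) :
    HasDerivAt (fun θ ↦ ∫ ω, f (rotationPath X Y θ ω) ∂P.prod Q)
      (∫ ω, f' (rotationPath X Y θ ω) (rotationPath X Y (θ + Real.pi / 2) ω) ∂P.prod Q) θ := by
  have := hX.isProbabilityMeasure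
  have := hY.isProbabilityMeasure
  have hlip : LipschitzWith C.toNNReal f :=
    lipschitzWith_of_nnnorm_fderiv_le (fun z ↦ (hf z).differentiableAt) fun z ↦ by
      rw [(hf z).fderiv, ← NNReal.coe_le_coe, coe_nnnorm]
      exact (hC z).trans (Real.le_coe_toNNReal C)
  have hgauss := hasGaussianLaw_rotationPath hX hY
  have hint (θ : ℝ) := integrable_comp_of_lipschitzWith hlip (hgauss θ θ).fst.integrable
  have hmeas : AEStronglyMeasurable
      (fun ω ↦ f' (rotationPath X Y θ ω) (rotationPath X Y (θ + Real.pi / 2) ω)) (P.prod Q) :=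
    ((by fun_prop : Continuous fun z : E × E ↦ f' z.1 z.2).measurable.comp_aemeasurable
      (hgauss θ (θ + Real.pi / 2)).aemeasurable).aestronglyMeasurable
  have hbound : Integrable (fun ω : Ω × Ω' ↦ C * (‖X ω.1‖ + ‖Y ω.2‖)) (P.prod Q) :=
    ((hX.integrable.norm.comp_fst Q).add (hY.integrable.norm.comp_snd P)).const_mul C
  exact (hasDerivAt_integral_of_dominated_loc_of_deriv_le
    (F := fun θ ω ↦ f (rotationPath X Y θ ω)) Filter.univ_mem
    (.of_forall fun θ ↦ (hint θ).aestronglyMeasurable) (hint θ) hmeas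
    (ae_of_all _ fun ω θ _ ↦ (f' _).le_of_opNorm_le_of_le (hC _) (norm_rotationPath_le X Y _ ω))
    hbound
    (ae_of_all _ fun ω θ _ ↦ (hf _).comp_hasDerivAt θ (hasDerivAt_rotationPath X Y θ ω))).2

end Gaussian

theorem integral_comp_le_integral_comp_of_hasGaussianLaw [FiniteDimensional ℝ E]
    [MeasurableSpace E] [BorelSpace E] {f : E → ℝ} {f' : E → E →L[ℝ] ℝ}
    {f'' : E → E →L[ℝ] E →L[ℝ] ℝ} {C C' : ℝ}
    (hX : HasGaussianLaw X P) (hY : HasGaussianLaw Y Q)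
    (hX0 : ∫ ω, X ω ∂P = 0) (hY0 : ∫ ω, Y ω ∂Q = 0)
    (hf : ∀ z, HasFDerivAt f (f' z) z) (hf' : ∀ z, HasFDerivAt f' (f'' z) z)
    (hC : ∀ z, ‖f' z‖ ≤ C) (hC' : ∀ z, ‖f'' z‖ ≤ C')
    (hle : ∀ z, ∫ ω, f'' z (X ω) (X ω) ∂P ≤ ∫ ω, f'' z (Y ω) (Y ω) ∂Q) :
    ∫ ω, f (X ω) ∂P ≤ ∫ ω, f (Y ω) ∂Q := by
  have := hX.isProbabilityMeasure
  have := hY.isProbabilityMeasure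
  have : CompleteSpace E := FiniteDimensional.complete ℝ E
  have hderiv := hasDerivAt_integral_comp_rotationPath hX hY hf
    (continuous_iff_continuousAt.2 fun z ↦ (hf' z).continuousAt) hC
  have hnonneg (θ : ℝ) (hθ : θ ∈ Set.Icc 0 (Real.pi / 2)) :
      0 ≤ ∫ ω, f' (rotationPath X Y θ ω) (rotationPath X Y (θ + Real.pi / 2) ω) ∂P.prod Q := by
    rw [integral_apply_of_hasGaussianLaw (hasGaussianLaw_rotationPath hX hY _ θ)
      (integral_rotationPath_eq_zero hX.integrable hY.integrable hX0 hY0 _) hf' hC hC']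
    refine integral_nonneg fun ω ↦ ?_
    rw [integral_bilin_rotationPath hX.memLp_two hY.memLp_two hX0 hY0]
    have hsin := Real.sin_nonneg_of_nonneg_of_le_pi hθ.1 (by linarith [hθ.2, Real.pi_pos])
    have hcos := Real.cos_nonneg_of_mem_Icc ⟨by linarith [hθ.1, Real.pi_pos], hθ.2⟩
    exact mul_nonneg (mul_nonneg hsin hcos) (sub_nonneg.2 (hle _))
  have hmono := monotoneOn_of_deriv_nonneg (convex_Icc 0 (Real.pi / 2))
    (fun θ _ ↦ (hderiv θ).continuousAt.continuousWithinAt)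
    (fun θ _ ↦ (hderiv θ).differentiableAt.differentiableWithinAt)
    (fun θ hθ ↦ (hderiv θ).deriv ▸ hnonneg θ (interior_subset hθ))
  have hends := hmono (Set.left_mem_Icc.2 (by positivity)) (Set.right_mem_Icc.2 (by positivity))
    (by positivity)
  simpa [rotationPath, integral_fun_fst (fun ω ↦ f (X ω)), integral_fun_snd (fun ω ↦ f (Y ω))]
    using hends

end Interpolation

section SmoothRange

variable {ι : Type*} [Fintype ι] {p a b : ι → ℝ}

/-- The mean `∑ i, p i * v i` of `v` under the weights `p`, as a linear form in `v`. -/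
noncomputable def meanForm (p : ι → ℝ) : (ι → ℝ) →L[ℝ] ℝ :=
  ∑ i, p i • ContinuousLinearMap.proj i

theorem meanForm_apply (p v : ι → ℝ) : meanForm p v = ∑ i, p i * v i := by
  simp [meanForm, sum_apply]

/-- The covariance of `v` and `w` under the weights `p`, as a bilinear form. -/
noncomputable def covForm (p : ι → ℝ) : (ι → ℝ) →L[ℝ] (ι → ℝ) →L[ℝ] ℝ :=
  ∑ i, (p i • (ContinuousLinearMap.proj i - meanForm p)).smulRight (ContinuousLinearMap.proj i)

theorem covForm_apply (p v w : ι → ℝ) :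
    covForm p v w = ∑ i, p i * (v i - meanForm p v) * w i := by
  simp [covForm, sum_apply]

theorem abs_meanForm_le (hp : p ∈ stdSimplex ℝ ι) (v : ι → ℝ) : |meanForm p v| ≤ ‖v‖ := by
  rw [meanForm_apply]
  calc |∑ i, p i * v i| ≤ ∑ i, |p i * v i| := Finset.abs_sum_le_sum_abs _ _
    _ ≤ ∑ i, p i * ‖v‖ := Finset.sum_le_sum fun i _ ↦ by
        rw [abs_mul, abs_of_nonneg (hp.1 i)]
        exact mul_le_mul_of_nonneg_left (norm_le_pi_norm v i) (hp.1 i)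
    _ = ‖v‖ := by rw [← Finset.sum_mul, hp.2, one_mul]

theorem norm_meanForm_le (hp : p ∈ stdSimplex ℝ ι) : ‖meanForm p‖ ≤ 1 :=
  ContinuousLinearMap.opNorm_le_bound _ zero_le_one fun v ↦ by
    simpa only [one_mul, Real.norm_eq_abs] using abs_meanForm_le hp v

theorem norm_covForm_le (hp : p ∈ stdSimplex ℝ ι) : ‖covForm p‖ ≤ 2 :=
  ContinuousLinearMap.opNorm_le_bound₂ _ zero_le_two fun v w ↦ by
    have hdev (i) : |v i - meanForm p v| ≤ 2 * ‖v‖ := by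
      rw [two_mul]
      exact (abs_sub _ _).trans (add_le_add (norm_le_pi_norm v i) (abs_meanForm_le hp v))
    rw [covForm_apply, Real.norm_eq_abs]
    calc |∑ i, p i * (v i - meanForm p v) * w i|
        ≤ ∑ i, |p i * (v i - meanForm p v) * w i| := Finset.abs_sum_le_sum_abs _ _
      _ ≤ ∑ i, p i * (2 * ‖v‖ * ‖w‖) := Finset.sum_le_sum fun i _ ↦ by
          rw [abs_mul, abs_mul, abs_of_nonneg (hp.1 i), mul_assoc]
          exact mul_le_mul_of_nonneg_left (mul_le_mul (hdev i) (norm_le_pi_norm w i)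
            (abs_nonneg _) (by positivity)) (hp.1 i)
      _ = 2 * ‖v‖ * ‖w‖ := by rw [← Finset.sum_mul, hp.2, one_mul]

theorem sum_mul_sq_sub_eq_covForm_add (ha : ∑ i, a i = 1) (hb : ∑ i, b i = 1) (v : ι → ℝ) :
    ∑ i, ∑ j, a i * b j * (v i - v j) ^ 2
      = covForm a v v + covForm b v v + (meanForm a v - meanForm b v) ^ 2 := by
  have hcov (p : ι → ℝ) : covForm p v v = ∑ i, p i * v i ^ 2 - meanForm p v ^ 2 := by
    rw [covForm_apply, sq (meanForm p v)]
    nth_rewrite 2 [meanForm_apply]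
    rw [Finset.sum_mul, ← Finset.sum_sub_distrib]
    exact Finset.sum_congr rfl fun i _ ↦ by ring
  have hinner (i : ι) : ∑ j, a i * b j * (v i - v j) ^ 2
      = a i * v i ^ 2 - 2 * meanForm b v * (a i * v i) + a i * ∑ j, b j * v j ^ 2 := by
    calc ∑ j, a i * b j * (v i - v j) ^ 2
        = a i * (v i ^ 2 * ∑ j, b j - 2 * v i * ∑ j, b j * v j + ∑ j, b j * v j ^ 2) := by
          rw [Finset.mul_sum, Finset.mul_sum, ← Finset.sum_sub_distrib, ← Finset.sum_add_distrib,
            Finset.mul_sum]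
          exact Finset.sum_congr rfl fun j _ ↦ by ring
      _ = _ := by rw [hb, meanForm_apply]; ring
  simp only [hinner]
  rw [Finset.sum_add_distrib, Finset.sum_sub_distrib, ← Finset.mul_sum, ← Finset.sum_mul, ha,
    ← meanForm_apply a v, hcov, hcov]
  ring

/-- The smooth maximum `log ∑ i, exp (z i)`. -/
noncomputable def logSumExp (z : ι → ℝ) : ℝ :=
  Real.log (∑ i, Real.exp (z i))

/-- The Gibbs weights `exp (z i) / ∑ j, exp (z j)`, i.e. the gradient of `logSumExp` at `z`. -/
noncomputable def softmax (z : ι → ℝ) (i : ι) : ℝ :=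
  Real.exp (z i) / ∑ j, Real.exp (z j)

section Nonempty

variable [Nonempty ι]

theorem sum_exp_pos (z : ι → ℝ) : 0 < ∑ i, Real.exp (z i) :=
  Finset.sum_pos (fun _ _ ↦ Real.exp_pos _) Finset.univ_nonempty

theorem softmax_mem_stdSimplex (z : ι → ℝ) : softmax z ∈ stdSimplex ℝ ι := by
  refine ⟨fun i ↦ div_nonneg (Real.exp_pos _).le (sum_exp_pos z).le, ?_⟩
  simp only [softmax]
  rw [← Finset.sum_div, div_self (sum_exp_pos z).ne']

theorem softmax_eq_exp_sub (z : ι → ℝ) (i : ι) : softmax z i = Real.exp (z i - logSumExp z) := by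
  rw [Real.exp_sub, logSumExp, Real.exp_log (sum_exp_pos z), softmax]

theorem hasFDerivAt_logSumExp (z : ι → ℝ) :
    HasFDerivAt logSumExp (meanForm (softmax z)) z := by
  have hsum : HasFDerivAt (fun z : ι → ℝ ↦ ∑ i, Real.exp (z i))
      (∑ i, Real.exp (z i) • ContinuousLinearMap.proj i) z :=
    .fun_sum fun i _ ↦ (hasFDerivAt_apply i z).exp
  refine (hsum.log (sum_exp_pos z).ne').congr_fderiv ?_
  simp only [meanForm, softmax, Finset.smul_sum, smul_smul, div_eq_inv_mul]

theorem hasFDerivAt_softmax_apply (z : ι → ℝ) (i : ι) :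
    HasFDerivAt (fun z ↦ softmax z i)
      (softmax z i • (ContinuousLinearMap.proj i - meanForm (softmax z))) z := by
  simp only [softmax_eq_exp_sub]
  exact ((hasFDerivAt_apply i z).sub (hasFDerivAt_logSumExp z)).exp

theorem hasFDerivAt_meanForm_softmax (z : ι → ℝ) :
    HasFDerivAt (fun z ↦ meanForm (softmax z)) (covForm (softmax z)) z :=
  .fun_sum fun i _ ↦ (hasFDerivAt_softmax_apply z i).smul_const
    (ContinuousLinearMap.proj (R := ℝ) (φ := fun _ : ι ↦ ℝ) i)

/-- The smooth version of `max z - min z` obtained from `logSumExp`. -/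
noncomputable def softRange (z : ι → ℝ) : ℝ :=
  logSumExp z + logSumExp (-z)

/-- The derivative of `softRange` at `z`. -/
noncomputable def softRangeGrad (z : ι → ℝ) : (ι → ℝ) →L[ℝ] ℝ :=
  meanForm (softmax z) - meanForm (softmax (-z))

/-- The second derivative of `softRange` at `z`. -/
noncomputable def softRangeHess (z : ι → ℝ) : (ι → ℝ) →L[ℝ] (ι → ℝ) →L[ℝ] ℝ :=
  covForm (softmax z) + covForm (softmax (-z))

theorem hasFDerivAt_softRange (z : ι → ℝ) : HasFDerivAt softRange (softRangeGrad z) z := by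
  have hneg := (hasFDerivAt_logSumExp (-z)).comp z (hasFDerivAt_id z).neg
  refine ((hasFDerivAt_logSumExp z).add hneg).congr_fderiv ?_
  ext; simp [softRangeGrad, sub_eq_add_neg]

theorem hasFDerivAt_softRangeGrad (z : ι → ℝ) :
    HasFDerivAt softRangeGrad (softRangeHess z) z := by
  have hneg := (hasFDerivAt_meanForm_softmax (-z)).comp z (hasFDerivAt_id z).neg
  refine ((hasFDerivAt_meanForm_softmax z).sub hneg).congr_fderiv ?_
  ext; simp [softRangeHess]

theorem norm_softRangeGrad_le (z : ι → ℝ) : ‖softRangeGrad z‖ ≤ 2 :=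
  (norm_sub_le_of_le (norm_meanForm_le (softmax_mem_stdSimplex z))
    (norm_meanForm_le (softmax_mem_stdSimplex (-z)))).trans_eq one_add_one_eq_two

theorem norm_softRangeHess_le (z : ι → ℝ) : ‖softRangeHess z‖ ≤ 4 := by
  have hpos := norm_covForm_le (softmax_mem_stdSimplex z)
  have hneg := norm_covForm_le (softmax_mem_stdSimplex (-z))
  exact (ContinuousLinearMap.opNorm_add_le _ _).trans (by linarith)

end Nonempty

end SmoothRange

section SmoothHinge

/-- The smooth version `log (1 + exp t)` of the hinge function `max t 0`. -/
noncomputable def softplus (t : ℝ) : ℝ :=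
  Real.log (1 + Real.exp t)

theorem hasDerivAt_softplus (t : ℝ) : HasDerivAt softplus (Real.sigmoid t) t := by
  refine (((Real.hasDerivAt_exp t).const_add 1).log (by positivity)).congr_deriv ?_
  rw [Real.sigmoid_def, Real.exp_neg]
  field_simp
  exact add_comm _ _

theorem max_zero_le_softplus (t : ℝ) : max t 0 ≤ softplus t :=
  max_le ((Real.le_log_iff_exp_le (by positivity)).2 (by linarith))
    (Real.log_nonneg (by linarith [Real.exp_pos t]))

theorem softplus_le_max_zero_add_log_two (t : ℝ) : softplus t ≤ max t 0 + Real.log 2 := by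
  have hone : 1 ≤ Real.exp (max t 0) := Real.one_le_exp (le_max_right t 0)
  have hexp : Real.exp t ≤ Real.exp (max t 0) := Real.exp_le_exp.2 (le_max_left t 0)
  calc softplus t ≤ Real.log (Real.exp (max t 0) * 2) :=
        Real.log_le_log (by positivity) (by linarith)
    _ = max t 0 + Real.log 2 := by rw [Real.log_mul (by positivity) two_ne_zero, Real.log_exp]

variable {ι : Type*} [Fintype ι]

/-- The smooth version `softplus (softRange z - a)` of `max (range z - a) 0`. -/
noncomputable def softHinge (a : ℝ) (z : ι → ℝ) : ℝ :=
  softplus (softRange z - a)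

/-- The derivative of `softHinge a` at `z`. -/
noncomputable def softHingeGrad (a : ℝ) (z : ι → ℝ) : (ι → ℝ) →L[ℝ] ℝ :=
  Real.sigmoid (softRange z - a) • softRangeGrad z

/-- The second derivative of `softHinge a` at `z`. -/
noncomputable def softHingeHess (a : ℝ) (z : ι → ℝ) : (ι → ℝ) →L[ℝ] (ι → ℝ) →L[ℝ] ℝ :=
  Real.sigmoid (softRange z - a) • softRangeHess z +
    ((Real.sigmoid (softRange z - a) * (1 - Real.sigmoid (softRange z - a))) •
      softRangeGrad z).smulRight (softRangeGrad z)

section Nonempty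

variable [Nonempty ι]

theorem hasFDerivAt_softHinge (a : ℝ) (z : ι → ℝ) :
    HasFDerivAt (softHinge a) (softHingeGrad a z) z :=
  (hasDerivAt_softplus _).comp_hasFDerivAt z ((hasFDerivAt_softRange z).sub_const a)

theorem hasFDerivAt_softHingeGrad (a : ℝ) (z : ι → ℝ) :
    HasFDerivAt (softHingeGrad a) (softHingeHess a z) z :=
  ((Real.hasDerivAt_sigmoid _).comp_hasFDerivAt z ((hasFDerivAt_softRange z).sub_const a)).smul
    (hasFDerivAt_softRangeGrad z)

theorem norm_softHingeGrad_le (a : ℝ) (z : ι → ℝ) : ‖softHingeGrad a z‖ ≤ 2 := by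
  rw [softHingeGrad, norm_smul, Real.norm_of_nonneg (Real.sigmoid_nonneg _)]
  exact (mul_le_of_le_one_left (norm_nonneg _) (Real.sigmoid_le_one _)).trans
    (norm_softRangeGrad_le z)

theorem norm_softHingeHess_le (a : ℝ) (z : ι → ℝ) : ‖softHingeHess a z‖ ≤ 8 := by
  rw [softHingeHess]
  set σ := Real.sigmoid (softRange z - a)
  have hσ0 : 0 ≤ σ := Real.sigmoid_nonneg _
  have hσ1 : σ ≤ 1 := Real.sigmoid_le_one _
  have hgrad := norm_softRangeGrad_le z
  have hfirst : ‖σ • softRangeHess z‖ ≤ 4 := by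
    refine (ContinuousLinearMap.opNorm_smul_le σ _).trans ?_
    rw [Real.norm_of_nonneg hσ0]
    exact (mul_le_of_le_one_left (norm_nonneg _) hσ1).trans (norm_softRangeHess_le z)
  have hsecond : ‖((σ * (1 - σ)) • softRangeGrad z).smulRight (softRangeGrad z)‖ ≤ 4 := by
    rw [ContinuousLinearMap.norm_smulRight_apply, norm_smul,
      Real.norm_of_nonneg (mul_nonneg hσ0 (sub_nonneg.2 hσ1))]
    have : σ * (1 - σ) ≤ 1 := by nlinarith
    have := mul_le_of_le_one_left (norm_nonneg (softRangeGrad z)) this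
    nlinarith [norm_nonneg (softRangeGrad z)]
  exact (ContinuousLinearMap.opNorm_add_le _ _).trans (by linarith)

theorem lipschitzWith_softHinge (a : ℝ) : LipschitzWith 2 (softHinge a : (ι → ℝ) → ℝ) :=
  lipschitzWith_of_nnnorm_fderiv_le (fun z ↦ (hasFDerivAt_softHinge a z).differentiableAt)
    fun z ↦ (hasFDerivAt_softHinge a z).fderiv ▸ norm_softHingeGrad_le a z

-- The squared gradient is a mixed double sum minus both covariances, so the covariances are left
-- with the nonnegative coefficient `σ - σ * (1 - σ) = σ ^ 2`, where `σ` is the sigmoid factor.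
theorem exists_softHingeHess_apply_self_eq_sum (a : ℝ) (z : ι → ℝ) :
    ∃ w : ι → ι → ℝ, (∀ i j, 0 ≤ w i j) ∧
      ∀ v, softHingeHess a z v v = ∑ i, ∑ j, w i j * (v i - v j) ^ 2 := by
  set σ := Real.sigmoid (softRange z - a) with hσ
  have hσ0 : 0 ≤ σ := Real.sigmoid_nonneg _
  have hσ1 : 0 ≤ 1 - σ := sub_nonneg.2 (Real.sigmoid_le_one _)
  obtain ⟨hp0, hp1⟩ := softmax_mem_stdSimplex z
  obtain ⟨hm0, hm1⟩ := softmax_mem_stdSimplex (-z)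
  set p := softmax z with hp
  set m := softmax (-z) with hm
  refine ⟨fun i j ↦ σ * (1 - σ) * (p i * m j) + σ ^ 2 / 2 * (p i * p j + m i * m j),
    fun i j ↦ ?_, fun v ↦ ?_⟩
  · have := mul_nonneg (hp0 i) (hm0 j)
    have := mul_nonneg (hp0 i) (hp0 j)
    have := mul_nonneg (hm0 i) (hm0 j)
    positivity
  · have hsplit : ∑ i, ∑ j, (σ * (1 - σ) * (p i * m j) + σ ^ 2 / 2 * (p i * p j + m i * m j))
          * (v i - v j) ^ 2
        = σ * (1 - σ) * ∑ i, ∑ j, p i * m j * (v i - v j) ^ 2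
          + σ ^ 2 / 2 * (∑ i, ∑ j, p i * p j * (v i - v j) ^ 2
            + ∑ i, ∑ j, m i * m j * (v i - v j) ^ 2) := by
      simp only [Finset.mul_sum, ← Finset.sum_add_distrib]
      exact Finset.sum_congr rfl fun i _ ↦ Finset.sum_congr rfl fun j _ ↦ by ring
    rw [hsplit, sum_mul_sq_sub_eq_covForm_add hp1 hm1, sum_mul_sq_sub_eq_covForm_add hp1 hp1,
      sum_mul_sq_sub_eq_covForm_add hm1 hm1]
    simp only [softHingeHess, softRangeHess, softRangeGrad, add_apply, smul_apply, sub_apply,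
      ContinuousLinearMap.smulRight_apply, smul_eq_mul, ← hσ, ← hp, ← hm]
    ring

end Nonempty

variable {Ω Ω' : Type*} [MeasurableSpace Ω] [MeasurableSpace Ω'] {P : Measure Ω} {Q : Measure Ω'}
  {X : Ω → ι → ℝ} {Y : Ω' → ι → ℝ}

theorem integral_sum_mul_sq_sub (hX : ∀ i, MemLp (X · i) 2 P) (w : ι → ι → ℝ) :
    ∫ ω, ∑ i, ∑ j, w i j * (X ω i - X ω j) ^ 2 ∂P
      = ∑ i, ∑ j, w i j * ∫ ω, (X ω i - X ω j) ^ 2 ∂P := by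
  have hint (i j : ι) : Integrable (fun ω ↦ w i j * (X ω i - X ω j) ^ 2) P :=
    ((hX i).sub (hX j)).integrable_sq.const_mul _
  rw [integral_finsetSum _ fun i _ ↦ integrable_finsetSum _ fun j _ ↦ hint i j]
  refine Finset.sum_congr rfl fun i _ ↦ ?_
  rw [integral_finsetSum _ fun j _ ↦ hint i j]
  exact Finset.sum_congr rfl fun j _ ↦ integral_const_mul _ _

theorem integral_softHinge_le_of_hasGaussianLaw [Nonempty ι]
    (hX : HasGaussianLaw X P) (hY : HasGaussianLaw Y Q)
    (hX0 : ∀ i, ∫ ω, X ω i ∂P = 0) (hY0 : ∀ i, ∫ ω, Y ω i ∂Q = 0)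
    (hinc : ∀ i j, ∫ ω, (X ω i - X ω j) ^ 2 ∂P ≤ ∫ ω, (Y ω i - Y ω j) ^ 2 ∂Q) (a : ℝ) :
    ∫ ω, softHinge a (X ω) ∂P ≤ ∫ ω, softHinge a (Y ω) ∂Q := by
  have hXi (i : ι) := (hX.eval i).memLp_two
  have hYi (i : ι) := (hY.eval i).memLp_two
  refine integral_comp_le_integral_comp_of_hasGaussianLaw hX hY ?_ ?_ (hasFDerivAt_softHinge a)
    (hasFDerivAt_softHingeGrad a) (norm_softHingeGrad_le a) (norm_softHingeHess_le a) fun z ↦ ?_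
  · exact funext fun i ↦ (eval_integral (fun i ↦ (hX.eval i).integrable) i).trans (hX0 i)
  · exact funext fun i ↦ (eval_integral (fun i ↦ (hY.eval i).integrable) i).trans (hY0 i)
  · obtain ⟨w, hw0, hw⟩ := exists_softHingeHess_apply_self_eq_sum a z
    simp only [hw]
    rw [integral_sum_mul_sq_sub hXi, integral_sum_mul_sq_sub hYi]
    gcongr with i _ j _
    exacts [hw0 i j, hinc i j]

end SmoothHinge

section Range

variable {ι : Type*}

theorem diam_range_le_diam_range_add [Fintype ι] (z w : ι → ℝ) :
    Metric.diam (Set.range z) ≤ Metric.diam (Set.range w) + 2 * dist z w := by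
  refine Metric.diam_le_of_forall_dist_le (by positivity) ?_
  rintro _ ⟨i, rfl⟩ _ ⟨j, rfl⟩
  have hw : dist (w i) (w j) ≤ Metric.diam (Set.range w) :=
    Metric.dist_le_diam_of_mem (Set.finite_range w).isBounded ⟨i, rfl⟩ ⟨j, rfl⟩
  linarith [dist_triangle4 (z i) (w i) (w j) (z j), dist_le_pi_dist z w i,
    dist_le_pi_dist w z j, dist_comm z w]

theorem lipschitzWith_diam_range [Fintype ι] :
    LipschitzWith 2 fun z : ι → ℝ ↦ Metric.diam (Set.range z) :=
  .of_le_add_mul 2 diam_range_le_diam_range_add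

theorem diam_range_smul (β : ℝ) (z : ι → ℝ) :
    Metric.diam (Set.range (β • z)) = |β| * Metric.diam (Set.range z) := by
  change Metric.diam (Set.range fun i ↦ β • z i) = _
  rw [Set.range_smul, diam_smul₀, Real.norm_eq_abs]

section Nonempty

variable [Fintype ι] [Nonempty ι]

theorem le_logSumExp (z : ι → ℝ) (i : ι) : z i ≤ logSumExp z :=
  (Real.le_log_iff_exp_le (sum_exp_pos z)).2 <|
    Finset.single_le_sum (f := fun i ↦ Real.exp (z i)) (fun _ _ ↦ (Real.exp_pos _).le)
      (Finset.mem_univ i)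

theorem exists_logSumExp_le (z : ι → ℝ) :
    ∃ i, logSumExp z ≤ z i + Real.log (Fintype.card ι) := by
  obtain ⟨i, hi⟩ := Finite.exists_max z
  have hcard : (Fintype.card ι : ℝ) ≠ 0 := Nat.cast_ne_zero.2 Fintype.card_ne_zero
  refine ⟨i, ?_⟩
  calc logSumExp z ≤ Real.log (Fintype.card ι * Real.exp (z i)) := by
        refine Real.log_le_log (sum_exp_pos z) ?_
        rw [← nsmul_eq_mul, ← Finset.card_univ]
        exact Finset.sum_le_card_nsmul _ _ _ fun j _ ↦ Real.exp_le_exp.2 (hi j)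
    _ = z i + Real.log (Fintype.card ι) := by
        rw [Real.log_mul hcard (Real.exp_pos _).ne', Real.log_exp, add_comm]

theorem diam_range_le_softRange (z : ι → ℝ) : Metric.diam (Set.range z) ≤ softRange z := by
  have hsub (i j : ι) : z i - z j ≤ softRange z := by
    simpa only [Pi.neg_apply, ← sub_eq_add_neg, softRange] using
      add_le_add (le_logSumExp z i) (le_logSumExp (-z) j)
  have hnonneg : 0 ≤ softRange z := by
    simpa only [sub_self] using hsub (Classical.arbitrary ι) (Classical.arbitrary ι)
  refine Metric.diam_le_of_forall_dist_le hnonneg ?_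
  rintro _ ⟨i, rfl⟩ _ ⟨j, rfl⟩
  exact abs_sub_le_iff.2 ⟨hsub i j, hsub j i⟩

theorem softRange_le_diam_range_add (z : ι → ℝ) :
    softRange z ≤ Metric.diam (Set.range z) + 2 * Real.log (Fintype.card ι) := by
  obtain ⟨i, hi⟩ := exists_logSumExp_le z
  obtain ⟨j, hj⟩ := exists_logSumExp_le (-z)
  have hdist : z i - z j ≤ Metric.diam (Set.range z) := (le_abs_self _).trans
    (Metric.dist_le_diam_of_mem (Set.finite_range z).isBounded ⟨i, rfl⟩ ⟨j, rfl⟩)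
  rw [Pi.neg_apply] at hj
  rw [softRange]
  linarith

theorem max_diam_range_sub_le_softHinge (a : ℝ) (z : ι → ℝ) :
    max (Metric.diam (Set.range z) - a) 0 ≤ softHinge a z :=
  (max_le_max_right 0 (sub_le_sub_right (diam_range_le_softRange z) a)).trans
    (max_zero_le_softplus _)

theorem softHinge_le_max_diam_range_sub_add (a : ℝ) (z : ι → ℝ) :
    softHinge a z ≤ max (Metric.diam (Set.range z) - a) 0
      + (2 * Real.log (Fintype.card ι) + Real.log 2) := by
  have hmax : max (softRange z - a) 0
      ≤ max (Metric.diam (Set.range z) - a) 0 + 2 * Real.log (Fintype.card ι) :=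
    max_le (by linarith [softRange_le_diam_range_add z,
      le_max_left (Metric.diam (Set.range z) - a) 0]) (by positivity)
  linarith [softplus_le_max_zero_add_log_two (softRange z - a), softHinge.eq_1 a z]

end Nonempty

variable {Ω Ω' : Type*} [MeasurableSpace Ω] [MeasurableSpace Ω'] {P : Measure Ω} {Q : Measure Ω'}
  {X : Ω → ι → ℝ} {Y : Ω' → ι → ℝ}

theorem integrable_max_diam_range_sub [Fintype ι] [IsFiniteMeasure P] (hX : Integrable X P)
    (a : ℝ) :
    Integrable (fun ω ↦ max (Metric.diam (Set.range (X ω)) - a) 0) P :=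
  (integrable_comp_of_lipschitzWith lipschitzWith_diam_range hX).sub (integrable_const a)
    |>.pos_part

theorem integral_max_diam_range_sub_le_add [Fintype ι] [Nonempty ι]
    (hX : HasGaussianLaw X P) (hY : HasGaussianLaw Y Q)
    (hX0 : ∀ i, ∫ ω, X ω i ∂P = 0) (hY0 : ∀ i, ∫ ω, Y ω i ∂Q = 0)
    (hinc : ∀ i j, ∫ ω, (X ω i - X ω j) ^ 2 ∂P ≤ ∫ ω, (Y ω i - Y ω j) ^ 2 ∂Q) (a : ℝ) :
    ∫ ω, max (Metric.diam (Set.range (X ω)) - a) 0 ∂P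
      ≤ ∫ ω, max (Metric.diam (Set.range (Y ω)) - a) 0 ∂Q
        + (2 * Real.log (Fintype.card ι) + Real.log 2) := by
  have := hX.isProbabilityMeasure
  have := hY.isProbabilityMeasure
  have hrangeY := integrable_max_diam_range_sub hY.integrable a
  calc ∫ ω, max (Metric.diam (Set.range (X ω)) - a) 0 ∂P
      ≤ ∫ ω, softHinge a (X ω) ∂P :=
        integral_mono (integrable_max_diam_range_sub hX.integrable a)
          (integrable_comp_of_lipschitzWith (lipschitzWith_softHinge a) hX.integrable)
          fun ω ↦ max_diam_range_sub_le_softHinge a (X ω)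
    _ ≤ ∫ ω, softHinge a (Y ω) ∂Q := integral_softHinge_le_of_hasGaussianLaw hX hY hX0 hY0 hinc a
    _ ≤ ∫ ω, max (Metric.diam (Set.range (Y ω)) - a) 0
          + (2 * Real.log (Fintype.card ι) + Real.log 2) ∂Q :=
        integral_mono (integrable_comp_of_lipschitzWith (lipschitzWith_softHinge a) hY.integrable)
          (hrangeY.add (integrable_const _)) fun ω ↦ softHinge_le_max_diam_range_sub_add a (Y ω)
    _ = _ := by
        rw [integral_add hrangeY (integrable_const _), integral_const, probReal_univ, one_smul]

-- Scaling both vectors by `β` divides the additive error by `β`.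
theorem integral_max_diam_range_sub_le [Finite ι] [Nonempty ι]
    (hX : HasGaussianLaw X P) (hY : HasGaussianLaw Y Q)
    (hX0 : ∀ i, ∫ ω, X ω i ∂P = 0) (hY0 : ∀ i, ∫ ω, Y ω i ∂Q = 0)
    (hinc : ∀ i j, ∫ ω, (X ω i - X ω j) ^ 2 ∂P ≤ ∫ ω, (Y ω i - Y ω j) ^ 2 ∂Q) (a : ℝ) :
    ∫ ω, max (Metric.diam (Set.range (X ω)) - a) 0 ∂P
      ≤ ∫ ω, max (Metric.diam (Set.range (Y ω)) - a) 0 ∂Q := by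
  have := Fintype.ofFinite ι
  set K := 2 * Real.log (Fintype.card ι) + Real.log 2 with hK
  have hKpos : 0 < K :=
    add_pos_of_nonneg_of_pos (by positivity) (Real.log_pos one_lt_two)
  refine le_of_forall_pos_le_add fun ε hε ↦ ?_
  set β := K / ε with hβ
  have hβpos : 0 < β := div_pos hKpos hε
  have hscale (z : ι → ℝ) : max (Metric.diam (Set.range (β • z)) - β * a) 0
      = β * max (Metric.diam (Set.range z) - a) 0 := by
    rw [diam_range_smul, abs_of_pos hβpos, ← mul_sub, mul_max_of_nonneg _ _ hβpos.le, mul_zero]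
  have hscaled := integral_max_diam_range_sub_le_add (hX.fun_smul β) (hY.fun_smul β)
    (fun i ↦ by simp only [Pi.smul_apply, integral_smul, hX0, smul_zero])
    (fun i ↦ by simp only [Pi.smul_apply, integral_smul, hY0, smul_zero])
    (fun i j ↦ by
      simp only [Pi.smul_apply, smul_eq_mul, ← mul_sub, mul_pow, integral_const_mul]
      exact mul_le_mul_of_nonneg_left (hinc i j) (sq_nonneg β)) (β * a)
  simp only [hscale, integral_const_mul, ← hK] at hscaled
  have hKβ : K = β * ε := by rw [hβ, div_mul_cancel₀ _ hε.ne']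
  rw [hKβ, ← mul_add] at hscaled
  exact le_of_mul_le_mul_left hscaled hβpos

end Range

section HingeMixture

variable {q t : ℝ}

theorem intervalIntegrable_sub_mul_rpow (hq : 1 < q) :
    IntervalIntegrable (fun a : ℝ ↦ (t - a) * a ^ (q - 2)) volume 0 t :=
  (intervalIntegral.intervalIntegrable_rpow' (by linarith)).continuousOn_mul (by fun_prop)

theorem intervalIntegral_sub_mul_rpow (hq : 1 < q) (ht : 0 ≤ t) :
    ∫ a in (0)..t, (t - a) * a ^ (q - 2) = (q * (q - 1))⁻¹ * t ^ q := by
  have hq1 : q - 1 ≠ 0 := by linarith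
  have hshift {a : ℝ} (ha : 0 ≤ a) : a ^ (q - 2) * a = a ^ (q - 1) := by
    rw [← Real.rpow_add_one' ha (by linarith), show q - 2 + 1 = q - 1 by ring]
  have hexpand (a : ℝ) (ha : a ∈ Set.uIcc 0 t) :
      (t - a) * a ^ (q - 2) = t * a ^ (q - 2) - a ^ (q - 1) := by
    rw [← hshift (Set.uIcc_of_le ht ▸ ha).1]
    ring
  have htq : t * t ^ (q - 1) = t ^ q := by
    rw [mul_comm, ← Real.rpow_add_one' ht (by linarith), sub_add_cancel]
  rw [intervalIntegral.integral_congr hexpand, intervalIntegral.integral_sub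
      ((intervalIntegral.intervalIntegrable_rpow' (by linarith)).const_mul t)
      (intervalIntegral.intervalIntegrable_rpow' (by linarith)),
    intervalIntegral.integral_const_mul, integral_rpow (.inl (by linarith)),
    integral_rpow (.inl (by linarith)), show q - 2 + 1 = q - 1 by ring, sub_add_cancel,
    Real.zero_rpow hq1, Real.zero_rpow (by linarith), sub_zero, sub_zero, mul_div_assoc', htq]
  field_simp
  ring

theorem lintegral_hinge_mul_rpow (hq : 1 < q) (ht : 0 ≤ t) :
    ∫⁻ a in Set.Ioi (0 : ℝ), ENNReal.ofReal (max (t - a) 0) * ENNReal.ofReal (a ^ (q - 2))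
      = ENNReal.ofReal ((q * (q - 1))⁻¹ * t ^ q) := by
  have hind (a : ℝ) :
      ENNReal.ofReal (max (t - a) 0) * ENNReal.ofReal (a ^ (q - 2))
        = (Set.Iic t).indicator (fun a ↦ ENNReal.ofReal ((t - a) * a ^ (q - 2))) a := by
    by_cases hat : a ≤ t
    · rw [Set.indicator_of_mem (Set.mem_Iic.2 hat), max_eq_left (sub_nonneg.2 hat),
        ENNReal.ofReal_mul (sub_nonneg.2 hat)]
    · rw [Set.indicator_of_notMem (by exact hat), max_eq_right (by linarith), ENNReal.ofReal_zero,
        zero_mul]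
  rw [lintegral_congr hind, setLIntegral_indicator measurableSet_Iic,
    Set.Iic_inter_Ioi, ← intervalIntegral_sub_mul_rpow hq ht, intervalIntegral.integral_of_le ht,
    ofReal_integral_eq_lintegral_ofReal (intervalIntegrable_sub_mul_rpow hq).1]
  refine (ae_restrict_iff' measurableSet_Ioc).2 (ae_of_all _ fun a ha ↦ ?_)
  exact mul_nonneg (sub_nonneg.2 ha.2) (Real.rpow_nonneg ha.1.le _)

variable {α β : Type*} [MeasurableSpace α] [MeasurableSpace β] {μ : Measure α} {ν : Measure β}
  [SFinite μ] {u : α → ℝ} {v : β → ℝ}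

theorem lintegral_rpow_eq_lintegral_hinge (hu : AEMeasurable u μ) (hu0 : ∀ x, 0 ≤ u x)
    (hq : 1 < q) :
    ∫⁻ x, ENNReal.ofReal (u x ^ q) ∂μ
      = ENNReal.ofReal (q * (q - 1)) * ∫⁻ a in Set.Ioi (0 : ℝ),
        (∫⁻ x, ENNReal.ofReal (max (u x - a) 0) ∂μ) * ENNReal.ofReal (a ^ (q - 2)) := by
  have hc : 0 < q * (q - 1) := mul_pos (by linarith) (by linarith)
  have hmix (x : α) : ENNReal.ofReal (u x ^ q) = ENNReal.ofReal (q * (q - 1)) *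
      ∫⁻ a in Set.Ioi (0 : ℝ), ENNReal.ofReal (max (u x - a) 0) * ENNReal.ofReal (a ^ (q - 2)) := by
    rw [lintegral_hinge_mul_rpow hq (hu0 x), ← ENNReal.ofReal_mul hc.le,
      mul_inv_cancel_left₀ hc.ne']
  have hmeas : AEMeasurable (fun z : α × ℝ ↦
      ENNReal.ofReal (max (u z.1 - z.2) 0) * ENNReal.ofReal (z.2 ^ (q - 2)))
      (μ.prod (volume.restrict (Set.Ioi 0))) := by
    have := hu.comp_fst (ν := volume.restrict (Set.Ioi (0 : ℝ)))
    fun_prop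
  simp only [hmix]
  rw [lintegral_const_mul' _ _ ENNReal.ofReal_ne_top, lintegral_lintegral_swap hmeas]
  simp only [lintegral_mul_const' _ _ ENNReal.ofReal_ne_top]

theorem lintegral_rpow_le_of_hinge_le [SFinite ν] (hu : AEMeasurable u μ) (hv : AEMeasurable v ν)
    (hu0 : ∀ x, 0 ≤ u x) (hv0 : ∀ x, 0 ≤ v x)
    (h : ∀ a, ∫⁻ x, ENNReal.ofReal (max (u x - a) 0) ∂μ
      ≤ ∫⁻ x, ENNReal.ofReal (max (v x - a) 0) ∂ν) (hq : 1 ≤ q) :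
    ∫⁻ x, ENNReal.ofReal (u x ^ q) ∂μ ≤ ∫⁻ x, ENNReal.ofReal (v x ^ q) ∂ν := by
  rcases hq.eq_or_lt with rfl | hq
  · simpa only [sub_zero, max_eq_left (hu0 _), max_eq_left (hv0 _), Real.rpow_one] using h 0
  · rw [lintegral_rpow_eq_lintegral_hinge hu hu0 hq, lintegral_rpow_eq_lintegral_hinge hv hv0 hq]
    gcongr
    exact h _

end HingeMixture

section SupAbs

variable {T Ω : Type*}

theorem supAbs_comp_le {S : Type*} (X : T → Ω → ℝ) (f : S → T) (ω : Ω) :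
    supAbs (X ∘ f) ω ≤ supAbs X ω :=
  iSup_comp_le (fun t ↦ ENNReal.ofReal |X t ω|) f

theorem supAbs_eq_iSup_finset (X : T → Ω → ℝ) (ω : Ω) :
    supAbs X ω = ⨆ I : Finset T, supAbs (fun t : I ↦ X t) ω := by
  simp only [supAbs, iSup_subtype, iSup_eq_iSup_finset fun t ↦ ENNReal.ofReal |X t ω|]

theorem supAbs_mono_set (X : T → Ω → ℝ) (ω : Ω) :
    Monotone fun S : Set T ↦ supAbs (fun t : S ↦ X t) ω :=
  fun _ _ hSS' ↦ supAbs_comp_le _ (Set.inclusion hSS') ω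

theorem aemeasurable_supAbs [Countable T] [MeasurableSpace Ω] {P : Measure Ω} {X : T → Ω → ℝ}
    (hX : ∀ t, AEMeasurable (X t) P) : AEMeasurable (supAbs X) P :=
  .iSup fun t ↦ (hX t).abs.ennreal_ofReal

theorem ofReal_diam_range_le_two_mul_supAbs (X : T → Ω → ℝ) (ω : Ω) :
    ENNReal.ofReal (Metric.diam (Set.range (X · ω))) ≤ 2 * supAbs X ω := by
  have hle (t : T) : ENNReal.ofReal |X t ω| ≤ supAbs X ω :=
    le_iSup (fun t ↦ ENNReal.ofReal |X t ω|) t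
  refine ENNReal.ofReal_toReal_le.trans (Metric.ediam_le ?_)
  rintro _ ⟨s, rfl⟩ _ ⟨t, rfl⟩
  calc edist (X s ω) (X t ω) = ENNReal.ofReal |X s ω - X t ω| := edist_dist _ _
    _ ≤ ENNReal.ofReal |X s ω| + ENNReal.ofReal |X t ω| :=
        (ENNReal.ofReal_le_ofReal (abs_sub _ _)).trans ENNReal.ofReal_add_le
    _ ≤ 2 * supAbs X ω := two_mul (supAbs X ω) ▸ add_le_add (hle s) (hle t)

theorem supAbs_le_ofReal_diam_range [Finite T] {X : T → Ω → ℝ} {t₀ : T} {ω : Ω}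
    (h0 : X t₀ ω = 0) : supAbs X ω ≤ ENNReal.ofReal (Metric.diam (Set.range (X · ω))) := by
  refine iSup_le fun t ↦ ENNReal.ofReal_le_ofReal ?_
  rw [← sub_zero (X t ω), ← h0]
  exact Metric.dist_le_diam_of_mem (Set.finite_range (X · ω)).isBounded ⟨t, rfl⟩ ⟨t₀, rfl⟩

theorem exists_countable_supAbs_eq {Z : Type*} [TopologicalSpace Z] [SecondCountableTopology Z]
    {c : Z → Ω → ℝ} (hc : ∀ ω, Continuous (c · ω)) (Φ : T → Z) :
    ∃ S : Set T, S.Countable ∧ ∀ ω, supAbs (fun t : S ↦ c (Φ t)) ω = supAbs (c ∘ Φ) ω := by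
  let := TopologicalSpace.induced Φ inferInstance
  have := TopologicalSpace.secondCountableTopology_induced T Z Φ
  obtain ⟨S, hS, hdense⟩ := TopologicalSpace.exists_countable_dense T
  refine ⟨S, hS, fun ω ↦ ?_⟩
  exact hdense.ciSup' (f := fun t ↦ ENNReal.ofReal |c (Φ t) ω|) <| ENNReal.continuous_ofReal.comp <|
    ((hc ω).comp continuous_induced_dom).abs

end SupAbs

section GaussianProcess

variable {T Ω Ω' : Type*} [MeasurableSpace Ω] [MeasurableSpace Ω'] {P : Measure Ω} {Q : Measure Ω'}
  {X : T → Ω → ℝ} {Y : T → Ω' → ℝ} {q : ℝ}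

namespace IsCenteredGaussianFamily

theorem comp_right {S : Type*} (hX : IsCenteredGaussianFamily X P) (f : S → T) :
    IsCenteredGaussianFamily (X ∘ f) P where
  isGaussianProcess := hX.isGaussianProcess.comp_right f
  integral_eq_zero s := hX.integral_eq_zero (f s)

theorem hasGaussianLaw_pi [Finite T] (hX : IsCenteredGaussianFamily X P) :
    HasGaussianLaw (fun ω t ↦ X t ω) P := by
  have := Fintype.ofFinite T
  exact (hX.isGaussianProcess.hasGaussianLaw Finset.univ).map
    (.pi fun t ↦ .proj (⟨t, Finset.mem_univ t⟩ : Finset.univ))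

end IsCenteredGaussianFamily

theorem lintegral_diam_range_rpow_le [Finite T] [Nonempty T] (hX : IsCenteredGaussianFamily X P)
    (hY : IsCenteredGaussianFamily Y Q)
    (hinc : ∀ s t, ∫ ω, (X s ω - X t ω) ^ 2 ∂P ≤ ∫ ω, (Y s ω - Y t ω) ^ 2 ∂Q) (hq : 1 ≤ q) :
    ∫⁻ ω, ENNReal.ofReal (Metric.diam (Set.range (X · ω))) ^ q ∂P
      ≤ ∫⁻ ω, ENNReal.ofReal (Metric.diam (Set.range (Y · ω))) ^ q ∂Q := by
  have := Fintype.ofFinite T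
  have hXG := hX.hasGaussianLaw_pi
  have hYG := hY.hasGaussianLaw_pi
  have := hXG.isProbabilityMeasure
  have := hYG.isProbabilityMeasure
  have hmeas := (lipschitzWith_diam_range (ι := T)).continuous.measurable
  simp only [ENNReal.ofReal_rpow_of_nonneg Metric.diam_nonneg (zero_le_one.trans hq)]
  refine lintegral_rpow_le_of_hinge_le (hmeas.comp_aemeasurable hXG.aemeasurable)
    (hmeas.comp_aemeasurable hYG.aemeasurable) (fun _ ↦ Metric.diam_nonneg)
    (fun _ ↦ Metric.diam_nonneg) (fun a ↦ ?_) hq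
  rw [← ofReal_integral_eq_lintegral_ofReal (integrable_max_diam_range_sub hXG.integrable a)
      (ae_of_all _ fun _ ↦ le_max_right _ _),
    ← ofReal_integral_eq_lintegral_ofReal (integrable_max_diam_range_sub hYG.integrable a)
      (ae_of_all _ fun _ ↦ le_max_right _ _)]
  exact ENNReal.ofReal_le_ofReal (integral_max_diam_range_sub_le hXG hYG hX.integral_eq_zero
    hY.integral_eq_zero hinc a)

theorem lintegral_supAbs_rpow_le_of_finite [Finite T] (hX : IsCenteredGaussianFamily X P)
    (hY : IsCenteredGaussianFamily Y Q)
    (hinc : ∀ s t, ∫ ω, (X s ω - X t ω) ^ 2 ∂P ≤ ∫ ω, (Y s ω - Y t ω) ^ 2 ∂Q)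
    {t₀ : T} (h0 : X t₀ =ᵐ[P] 0) (hq : 1 ≤ q) :
    ∫⁻ ω, supAbs X ω ^ q ∂P ≤ 2 ^ q * ∫⁻ ω, supAbs Y ω ^ q ∂Q := by
  have : Nonempty T := ⟨t₀⟩
  have hq0 : 0 ≤ q := zero_le_one.trans hq
  calc ∫⁻ ω, supAbs X ω ^ q ∂P
      ≤ ∫⁻ ω, ENNReal.ofReal (Metric.diam (Set.range (X · ω))) ^ q ∂P :=
        lintegral_mono_ae <| h0.mono fun ω hω ↦
          ENNReal.rpow_le_rpow (supAbs_le_ofReal_diam_range hω) hq0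
    _ ≤ ∫⁻ ω, ENNReal.ofReal (Metric.diam (Set.range (Y · ω))) ^ q ∂Q :=
        lintegral_diam_range_rpow_le hX hY hinc hq
    _ ≤ ∫⁻ ω, (2 * supAbs Y ω) ^ q ∂Q := lintegral_mono fun ω ↦
        ENNReal.rpow_le_rpow (ofReal_diam_range_le_two_mul_supAbs Y ω) hq0
    _ = 2 ^ q * ∫⁻ ω, supAbs Y ω ^ q ∂Q := by
        simp only [ENNReal.mul_rpow_of_nonneg _ _ hq0]
        exact lintegral_const_mul' _ _ (ENNReal.rpow_ne_top_of_nonneg hq0 ENNReal.ofNat_ne_top)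

theorem lintegral_supAbs_rpow_eq_iSup_finset [Countable T] (hX : ∀ t, AEMeasurable (X t) P)
    (hq : 0 < q) :
    ∫⁻ ω, supAbs X ω ^ q ∂P = ⨆ I : Finset T, ∫⁻ ω, supAbs (fun t : I ↦ X t) ω ^ q ∂P := by
  have hmono : Monotone fun (I : Finset T) ω ↦ supAbs (fun t : I ↦ X t) ω ^ q := fun I J hIJ ω ↦
    ENNReal.rpow_le_rpow (supAbs_mono_set X ω (Finset.coe_subset.2 hIJ)) hq.le
  rw [← lintegral_iSup_directed
    (fun I ↦ (aemeasurable_supAbs fun t : I ↦ hX t).pow_const q) hmono.directed_le]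
  refine lintegral_congr fun ω ↦ ?_
  rw [supAbs_eq_iSup_finset]
  exact (ENNReal.orderIsoRpow q hq).map_iSup _

theorem lintegral_supAbs_rpow_le_of_countable [Countable T] (hX : IsCenteredGaussianFamily X P)
    (hY : IsCenteredGaussianFamily Y Q)
    (hinc : ∀ s t, ∫ ω, (X s ω - X t ω) ^ 2 ∂P ≤ ∫ ω, (Y s ω - Y t ω) ^ 2 ∂Q)
    {t₀ : T} (h0 : X t₀ =ᵐ[P] 0) (hq : 1 ≤ q) :
    ∫⁻ ω, supAbs X ω ^ q ∂P ≤ 2 ^ q * ∫⁻ ω, supAbs Y ω ^ q ∂Q := by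
  classical
  have hq0 : 0 < q := zero_lt_one.trans_le hq
  rw [lintegral_supAbs_rpow_eq_iSup_finset hX.isGaussianProcess.aemeasurable hq0]
  refine iSup_le fun I ↦ ?_
  let J : Finset T := insert t₀ I
  calc ∫⁻ ω, supAbs (fun t : I ↦ X t) ω ^ q ∂P ≤ ∫⁻ ω, supAbs (fun t : J ↦ X t) ω ^ q ∂P :=
        lintegral_mono fun ω ↦ ENNReal.rpow_le_rpow
          (supAbs_mono_set X ω (Finset.coe_subset.2 (Finset.subset_insert t₀ I))) hq0.le
    _ ≤ 2 ^ q * ∫⁻ ω, supAbs (fun t : J ↦ Y t) ω ^ q ∂Q :=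
        lintegral_supAbs_rpow_le_of_finite (hX.comp_right Subtype.val) (hY.comp_right Subtype.val)
          (fun s t ↦ hinc s t) (t₀ := ⟨t₀, Finset.mem_insert_self t₀ I⟩) h0 hq
    _ ≤ 2 ^ q * ∫⁻ ω, supAbs Y ω ^ q ∂Q := mul_le_mul_right (lintegral_mono fun ω ↦
        ENNReal.rpow_le_rpow (supAbs_comp_le Y _ ω) hq0.le) _

theorem lintegral_supAbs_rpow_le (hX : IsCenteredGaussianFamily X P)
    (hY : IsCenteredGaussianFamily Y Q)
    (hinc : ∀ s t, ∫ ω, (X s ω - X t ω) ^ 2 ∂P ≤ ∫ ω, (Y s ω - Y t ω) ^ 2 ∂Q)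
    {S : Set T} (hS : S.Countable) (hsup : ∀ᵐ ω ∂P, supAbs (fun t : S ↦ X t) ω = supAbs X ω)
    {t₀ : T} (h0 : X t₀ =ᵐ[P] 0) (hq : 1 ≤ q) :
    ∫⁻ ω, supAbs X ω ^ q ∂P ≤ 2 ^ q * ∫⁻ ω, supAbs Y ω ^ q ∂Q := by
  have hq0 : 0 ≤ q := zero_le_one.trans hq
  let S' : Set T := insert t₀ S
  have : Countable S' := (hS.insert t₀).to_subtype
  calc ∫⁻ ω, supAbs X ω ^ q ∂P ≤ ∫⁻ ω, supAbs (fun t : S' ↦ X t) ω ^ q ∂P :=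
        lintegral_mono_ae <| hsup.mono fun ω hω ↦ ENNReal.rpow_le_rpow
          (hω ▸ supAbs_mono_set X ω (Set.subset_insert t₀ S)) hq0
    _ ≤ 2 ^ q * ∫⁻ ω, supAbs (fun t : S' ↦ Y t) ω ^ q ∂Q :=
        lintegral_supAbs_rpow_le_of_countable (hX.comp_right Subtype.val)
          (hY.comp_right Subtype.val) (fun s t ↦ hinc s t)
          (t₀ := ⟨t₀, Set.mem_insert t₀ S⟩) h0 hq
    _ ≤ 2 ^ q * ∫⁻ ω, supAbs Y ω ^ q ∂Q := mul_le_mul_right (lintegral_mono fun ω ↦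
        ENNReal.rpow_le_rpow (supAbs_comp_le Y _ ω) hq0) _

end GaussianProcess

section GaussianSum

variable {E Ω : Type*} [NormedAddCommGroup E] [NormedSpace ℝ E] {M : ℕ}

theorem exists_countable_supAbs_gaussianSum_eq (g : Fin M → Ω → ℝ) {Ψ : ℝ × ℝ → ℝ}
    (hΨ : Continuous Ψ) (x y : Fin M → E) : ∃ S : Set (DualUnitBall E), S.Countable ∧ ∀ ω,
      supAbs (fun f : S ↦ gaussianSum g Ψ x y f) ω = supAbs (gaussianSum g Ψ x y) ω :=
  exists_countable_supAbs_eq (c := fun (z : Fin M → ℝ × ℝ) ω ↦ ∑ j, g j ω * Ψ (z j))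
    (fun ω ↦ by fun_prop) fun (f : DualUnitBall E) j ↦ (f.1 (x j), f.1 (y j))

variable [MeasurableSpace Ω] {P : Measure Ω} {g : Fin M → Ω → ℝ}

theorem isCenteredGaussianFamily_gaussianSum (hg : IsOrthogaussian g P) (Ψ : ℝ × ℝ → ℝ)
    (x y : Fin M → E) : IsCenteredGaussianFamily (gaussianSum g Ψ x y) P where
  isGaussianProcess := by
    have hlaw := hg.iIndepFun.hasGaussianLaw fun j ↦ (hg.hasLaw j).hasGaussianLaw
    refine ⟨fun I ↦ ?_⟩
    let L : (Fin M → ℝ) →L[ℝ] I → ℝ := .pi fun f : I ↦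
      ∑ j, Ψ (f.1.1 (x j), f.1.1 (y j)) • ContinuousLinearMap.proj j
    refine (hlaw.map_fun L).congr (ae_of_all _ fun ω ↦ funext fun f ↦ ?_)
    simp [L, gaussianSum, mul_comm, sum_apply]
  integral_eq_zero f := by
    have hint (j : Fin M) : Integrable (g j) P := (hg.hasLaw j).hasGaussianLaw.integrable
    have hmean (j : Fin M) : ∫ ω, g j ω ∂P = 0 := by
      rw [(hg.hasLaw j).integral_eq, integral_id_gaussianReal]
    simp only [gaussianSum]
    rw [integral_finsetSum _ fun j _ ↦ (hint j).mul_const _]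
    simp only [integral_mul_const, hmean, zero_mul, Finset.sum_const_zero]

theorem mainTheorem7_general {Ω' : Type*} [MeasurableSpace Ω'] {Q : Measure Ω'}
    (hg : IsOrthogaussian g P) {Ψ : ℝ × ℝ → ℝ} (hΨ : Continuous Ψ) (hΨ0 : Ψ (0, 0) = 0)
    (x y : Fin M → E) {G₂ : DualUnitBall E → Ω' → ℝ} (hG₂ : IsCenteredGaussianFamily G₂ Q)
    (hinc : ∀ f h : DualUnitBall E,
      ∫ ω, |gaussianSum g Ψ x y f ω - gaussianSum g Ψ x y h ω| ^ 2 ∂P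
        ≤ ∫ ω, |G₂ f ω - G₂ h ω| ^ 2 ∂Q) :
    IsCenteredGaussianFamily (gaussianSum g Ψ x y) P ∧
    AEMeasurable (supAbs (gaussianSum g Ψ x y)) P ∧
    ∀ q : ℝ, 1 ≤ q →
      ∫⁻ ω, supAbs (gaussianSum g Ψ x y) ω ^ q ∂P ≤ 2 ^ q * ∫⁻ ω, supAbs G₂ ω ^ q ∂Q := by
  simp only [sq_abs] at hinc
  have hG₁ := isCenteredGaussianFamily_gaussianSum hg Ψ x y
  obtain ⟨S, hS, hsup⟩ := exists_countable_supAbs_gaussianSum_eq g hΨ x y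
  have : Countable S := hS.to_subtype
  refine ⟨hG₁, ?_, fun q hq ↦ ?_⟩
  · rw [← funext hsup]
    exact aemeasurable_supAbs fun f : S ↦ hG₁.isGaussianProcess.aemeasurable f
  · have hzero (ω : Ω) : gaussianSum g Ψ x y ⟨0, Metric.mem_closedBall_self zero_le_one⟩ ω = 0 := by
      simp only [gaussianSum, zero_apply, hΨ0, mul_zero, Finset.sum_const_zero]
    exact lintegral_supAbs_rpow_le hG₁ hG₂ hinc hS (ae_of_all _ hsup) (ae_of_all _ hzero) hq

end GaussianSum

theorem mainTheorem7
    {E : Type*} [NormedAddCommGroup E] [NormedSpace ℝ E] [CompleteSpace E]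
    {Ω : Type*} [MeasurableSpace Ω] (P : Measure Ω) [IsProbabilityMeasure P] [P.IsComplete]
    (M : ℕ) (g : Fin M → Ω → ℝ) (hg : IsOrthogaussian g P)
    (Ψ : ℝ × ℝ → ℝ) (hΨ : Continuous Ψ) (hΨ0 : Ψ (0, 0) = 0)
    (x y : Fin M → E)
    (G₂ : DualUnitBall E → Ω → ℝ) (hG₂ : IsCenteredGaussianFamily G₂ P)
    (hinc : ∀ f h : DualUnitBall E,
      ∫ ω, |gaussianSum g Ψ x y f ω - gaussianSum g Ψ x y h ω| ^ 2 ∂P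
        ≤ ∫ ω, |G₂ f ω - G₂ h ω| ^ 2 ∂P) :
    IsCenteredGaussianFamily (gaussianSum g Ψ x y) P ∧
    AEMeasurable (supAbs (gaussianSum g Ψ x y)) P ∧
    ∀ q : ℝ, 1 ≤ q →
      ∫⁻ ω, (supAbs (gaussianSum g Ψ x y) ω) ^ q ∂P
        ≤ 2 ^ q * ∫⁻ ω, (supAbs G₂ ω) ^ q ∂P :=
  mainTheorem7_general hg hΨ hΨ0 x y hG₂ hinc
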